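/- For $a,q\in\mathbb{C}$ write $(a;q)_n=\prod_{k=0}^{n-1}(1-aq^k)$ and, for $|q|<1$, $(a;q)_\infty=\lim_{n\to\infty}(a;q)_n$. Let $$p_n(x;\alpha,\beta:q)=\sum_{k=0}^{n}\frac{(q^{-n};q)_k(\alpha\beta q^{n+1};q)_k}{(q;q)_k(\alpha q;q)_k}(qx)^k$$ be the little $q$-Jacobi polynomial. An overpartition of $n$ is a partition of $n$ in which the first occurrence of each part may be overlined; for $n\ge1$ let $\overline{p}_\omega(n)$ be the number of overpartitions of $n$ in which the smallest part is overlined and all odd parts are less than twice the smallest part. **Theorem.** Let $q\in\mathbb{C}$ with $0<|q|<1$. Then all the series below converge absolutely, $$\sum_{n=0}^{\infty}\frac{q^{n}(-q^3;q^2)_n(q;q)_n}{(q^3;q^2)_n(-q^2;q)_n}=\frac12\Bigl(1-\frac1q\Bigr)\frac{(q;q)_\infty^2}{(-q;q)_\infty^2}\sum_{n=0}^{\infty}\frac{(-1;q)_n(-q;q^2)_n}{(q;q^2)_n(q;q)_n}q^n+\frac1q\frac{(-q;q^2)_\infty}{(q^3;q^2)_\infty}\sum_{n=0}^{\infty}\frac{(q;q^2)_n(-q)^n}{(-q;q^2)_n(1+q^{2n})}\,p_{2n}(-1;q^{-2n-1},-1:q),$$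 and consequently $$\sum_{n=1}^{\infty}\overline{p}_\omega(n)q^n=-\frac12\frac{(q;q)_\infty(q;q^2)_\infty}{(-q;q)_\infty(-q;q^2)_\infty}\sum_{n=0}^{\infty}\frac{(-1;q)_n(-q;q^2)_n}{(q;q^2)_n(q;q)_n}q^n+\frac{(-q;q)_\infty}{(q;q)_\infty}\sum_{n=0}^{\infty}\frac{(q;q^2)_n(-q)^n}{(-q;q^2)_n(1+q^{2n})}\,p_{2n}(-1;q^{-2n-1},-1:q).$$ -/

import Mathlib

open scoped BigOperators Topology

noncomputable section

/-- The finite `q`-shifted factorial `(a;q)_n = (1-a)(1-aq)⋯(1-aq^{n-1})`. -/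
def qPoch (a q : ℂ) (n : ℕ) : ℂ := ∏ k ∈ Finset.range n, (1 - a * q ^ k)

/-- The infinite `q`-shifted factorial `(a;q)_∞ = ∏_{k ≥ 0} (1 - aq^k)`, for `|q| < 1`. -/
def qPochInf (a q : ℂ) : ℂ := ∏' k : ℕ, (1 - a * q ^ k)

/-- For `|q| < 1`, `(a;q)_∞` is the limit of `(a;q)_n` as `n → ∞`. -/
theorem tendsto_qPoch (a q : ℂ) (hq : ‖q‖ < 1) :
    Filter.Tendsto (qPoch a q) Filter.atTop (𝓝 (qPochInf a q)) := by
  have hs : Summable fun k : ℕ => ‖-(a * q ^ k)‖ := by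
    simp only [norm_neg, norm_mul, norm_pow]
    exact (summable_geometric_of_lt_one (norm_nonneg q) hq).mul_left _
  have hm : Multipliable fun k : ℕ => (1 - a * q ^ k) := by
    simpa [sub_eq_add_neg] using multipliable_one_add_of_summable hs
  exact hm.hasProd.tendsto_prod_nat

/-- The little `q`-Jacobi polynomial
`p_n(x; α, β : q) = ₂φ₁(q^{-n}, αβq^{n+1}; αq; q, qx)`. The series terminates at `k = n`
because of the numerator parameter `q^{-n}`, and is written as the finite sum. -/
def littleQJacobi (n : ℕ) (x α β q : ℂ) : ℂ :=
  ∑ k ∈ Finset.range (n + 1),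
    (qPoch (q ^ (-(n : ℤ))) q k * qPoch (α * β * q ^ (n + 1)) q k) /
      (qPoch q q k * qPoch (α * q) q k) * (q * x) ^ k

/-- An overpartition of `n`: a partition of `n` in which (the first occurrence of) each part size
may or may not be overlined. `overlined` is the set of overlined part sizes. -/
@[ext]
structure Overpartition (n : ℕ) where
  toPartition : Nat.Partition n
  overlined : Finset ℕ
  overlined_subset : overlined ⊆ toPartition.parts.toFinset

/-- There are finitely many overpartitions of `n`. -/
instance Overpartition.instFinite (n : ℕ) : Finite (Overpartition n) := by
  let f : Overpartition n → (Σ p : Nat.Partition n, {S // S ∈ p.parts.toFinset.powerset}) :=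
    fun π => ⟨π.toPartition, ⟨π.overlined, Finset.mem_powerset.2 π.overlined_subset⟩⟩
  refine Finite.of_injective f ?_
  rintro ⟨p, S, hS⟩ ⟨p', S', hS'⟩ h
  obtain ⟨rfl, h2⟩ := Sigma.mk.inj h
  have h3 : S = S' := congrArg Subtype.val (eq_of_heq h2)
  subst h3
  rfl

/-- The overpartitions that have a smallest part `m`, in which `m` is overlined and all odd parts
are less than `2m`. -/
def Overpartition.IsOmega {n : ℕ} (π : Overpartition n) : Prop :=
  ∃ m : ℕ, IsLeast {j | j ∈ π.toPartition.parts} m ∧ m ∈ π.overlined ∧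
    ∀ j ∈ π.toPartition.parts, Odd j → j < 2 * m

/-- `p̄_ω(n)`: the number of overpartitions of `n` in which the smallest part is overlined and all
odd parts are less than twice the smallest part. -/
def overpOmega (n : ℕ) : ℕ := Nat.card {π : Overpartition n // π.IsOmega}

end

/-!
The proof has an analytic part and a combinatorial part. Throughout, `|q| < 1`.

*Analytic part.* By the `q`-binomial theorem (`hasSum_qBinomial`),
`(-x;q²)_n / (x;q²)_n = C ∑_m (-1;q²)_m / (q²;q²)_m (-x q^{2n})^m` with
`C = (-x;q²)_∞ / (x;q²)_∞` (`hasSum_qPoch_neg_div`). This is inserted in each of the two series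
without little `q`-Jacobi polynomials, and the order of summation is interchanged
(`exists_hasSum_exchange`).

For `∑ (-1;q)_n (-q;q²)_n / ((q;q²)_n (q;q)_n) qⁿ`, with `x = q`, the inner sum over `n` is again a
`q`-binomial series, and the result is a multiple of
`U = ∑ (q;q²)_m (-q)^m / ((-q;q²)_m (1 + q^{2m}))` (`hasSum_qPoch_transform`).

For the first series of the theorem, with `x = q³`, the inner sum is `G(q^{2m+1})`, where
`G(z) = ∑ (q;q)_n / (-q²;q)_n zⁿ`. This function satisfies the first-order `q`-difference equation
`(1 - z) G(z) = (1 + q) - q (1 + z) G(qz)`, and solving it along `q, q², q³, …` gives an explicit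
multiple of `∑_{k ≤ 2m} (-1;q)_k / (q;q)_k (-q)^k - (q;q)_∞ / (-q;q)_∞` (`qRatioSeries_pow`). The
partial sum is the little `q`-Jacobi polynomial `p_{2m}(-1; q^{-2m-1}, -1 : q)`
(`littleQJacobi_eq_sum`), and the subtracted constant contributes a multiple of `U`, which is the
other series just evaluated (`hasSum_omega_transform`).

*Combinatorial part.* The overpartitions with overlined smallest part `m` and odd parts less than
`2m` have the generating function
`q^m / (1 - q^m) · ∏_{m < j < 2m} (1 + q^j) / (1 - q^j) · ∏_{i ≥ m} (1 + q^{2i}) / (1 - q^{2i})`,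
which is a constant multiple of the term of index `m - 1` of the first series
(`hasSum_omegaCount_mul_pow`). Summing over `m` gives `hasSum_overpOmega`. The product formula comes
from Mathlib's formal identity for `Nat.Partition.genFun`; it is evaluated at a complex number by
bounding the parts by `N`, where the product is finite, and letting `N` tend to infinity by dominated
convergence (`tendsto_prod_partitionWeight`).
-/

open Filter

/-! ### Shifted factorials -/

theorem qPoch_zero (a q : ℂ) : qPoch a q 0 = 1 := by simp [qPoch]

theorem qPoch_succ (a q : ℂ) (n : ℕ) : qPoch a q (n + 1) = qPoch a q n * (1 - a * q ^ n) :=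
  Finset.prod_range_succ _ _

theorem qPoch_add (a q : ℂ) (m n : ℕ) :
    qPoch a q (m + n) = qPoch a q m * qPoch (a * q ^ m) q n := by
  simp only [qPoch, Finset.prod_range_add, pow_add, mul_assoc]

theorem qPoch_succ' (a q : ℂ) (n : ℕ) : qPoch a q (n + 1) = (1 - a) * qPoch (a * q) q n := by
  rw [add_comm, qPoch_add]
  simp [qPoch]

theorem norm_mul_pow_lt_one {a q : ℂ} (ha : ‖a‖ < 1) (hq : ‖q‖ < 1) (n : ℕ) : ‖a * q ^ n‖ < 1 := by
  rw [norm_mul, norm_pow]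
  exact (mul_le_of_le_one_right (norm_nonneg a) (pow_le_one₀ (norm_nonneg q) hq.le)).trans_lt ha

theorem one_sub_ne_zero_of_norm_lt_one {a : ℂ} (ha : ‖a‖ < 1) : 1 - a ≠ 0 := by
  intro h
  rw [← sub_eq_zero.1 h, norm_one] at ha
  exact lt_irrefl _ ha

theorem one_add_ne_zero_of_norm_lt_one {a : ℂ} (ha : ‖a‖ < 1) : 1 + a ≠ 0 := by
  simpa using one_sub_ne_zero_of_norm_lt_one (a := -a) (by simpa using ha)

theorem norm_pow_lt_one {q : ℂ} (hq : ‖q‖ < 1) {n : ℕ} (hn : n ≠ 0) : ‖q ^ n‖ < 1 := by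
  rw [norm_pow]
  exact pow_lt_one₀ (norm_nonneg q) hq hn

theorem qPoch_ne_zero {a q : ℂ} (ha : ‖a‖ < 1) (hq : ‖q‖ < 1) (n : ℕ) : qPoch a q n ≠ 0 :=
  Finset.prod_ne_zero_iff.2 fun k _ =>
    one_sub_ne_zero_of_norm_lt_one (norm_mul_pow_lt_one ha hq k)

theorem qPochInf_ne_zero {a q : ℂ} (ha : ‖a‖ < 1) (hq : ‖q‖ < 1) : qPochInf a q ≠ 0 := by
  have hs : Summable fun k : ℕ => ‖-(a * q ^ k)‖ := by
    simp only [norm_neg, norm_mul, norm_pow]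
    exact (summable_geometric_of_lt_one (norm_nonneg q) hq).mul_left _
  have h := tprod_one_add_ne_zero_of_summable (f := fun k : ℕ => -(a * q ^ k))
    (fun k => by
      simpa [sub_eq_add_neg] using
        one_sub_ne_zero_of_norm_lt_one (norm_mul_pow_lt_one ha hq k)) hs
  simpa [qPochInf, sub_eq_add_neg] using h

theorem qPochInf_eq_qPoch_mul (a : ℂ) {q : ℂ} (hq : ‖q‖ < 1) (n : ℕ) :
    qPochInf a q = qPoch a q n * qPochInf (a * q ^ n) q := by
  have h := ((tendsto_qPoch a q hq).comp (tendsto_add_atTop_nat n))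
  refine tendsto_nhds_unique h (((tendsto_qPoch (a * q ^ n) q hq).const_mul _).congr fun k => ?_)
  simp [← qPoch_add, add_comm]

/-- `(a;q)_{2n}` splits into its factors of even and of odd index. -/
theorem qPoch_two_mul (a q : ℂ) (n : ℕ) :
    qPoch a q (2 * n) = qPoch a (q ^ 2) n * qPoch (a * q) (q ^ 2) n := by
  induction n with
  | zero => simp [qPoch]
  | succ n ih =>
    rw [show 2 * (n + 1) = 2 * n + 1 + 1 by ring, qPoch_succ, qPoch_succ, ih, qPoch_succ,
      qPoch_succ]
    ring

/-- `(a;q)_∞` splits into its factors of even and of odd index. -/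
theorem qPochInf_eq_mul (a : ℂ) {q : ℂ} (hq : ‖q‖ < 1) :
    qPochInf a q = qPochInf a (q ^ 2) * qPochInf (a * q) (q ^ 2) := by
  have hq2 : ‖q ^ 2‖ < 1 := norm_pow_lt_one hq two_ne_zero
  have h := (tendsto_qPoch a q hq).comp (tendsto_id.const_mul_atTop' (r := 2) two_pos)
  refine tendsto_nhds_unique h
    (((tendsto_qPoch a _ hq2).mul (tendsto_qPoch (a * q) _ hq2)).congr fun k => ?_)
  simp [qPoch_two_mul]

theorem tendsto_qPoch_div (a : ℂ) {b q : ℂ} (hb : ‖b‖ < 1) (hq : ‖q‖ < 1) :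
    Tendsto (fun n => qPoch a q n / qPoch b q n) atTop (𝓝 (qPochInf a q / qPochInf b q)) :=
  (tendsto_qPoch a q hq).div (tendsto_qPoch b q hq) (qPochInf_ne_zero hb hq)

theorem exists_norm_le_of_tendsto {u : ℕ → ℂ} {l : ℂ} (h : Tendsto u atTop (𝓝 l)) :
    ∃ B, ∀ n, ‖u n‖ ≤ B := by
  obtain ⟨B, hB⟩ := h.norm.bddAbove_range
  exact ⟨B, fun n => hB ⟨n, rfl⟩⟩

theorem summable_mul_pow_of_norm_le {u : ℕ → ℂ} {B : ℝ} (hB : ∀ n, ‖u n‖ ≤ B) {z : ℂ}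
    (hz : ‖z‖ < 1) : Summable fun n => u n * z ^ n := by
  refine Summable.of_norm_bounded ((summable_geometric_of_lt_one (norm_nonneg z) hz).mul_left B)
    fun n => ?_
  rw [norm_mul, norm_pow]
  exact mul_le_mul_of_nonneg_right (hB n) (by positivity)

/-! ### The `q`-binomial theorem -/

/-- The functional equation `(1 - z) f(z) = (1 - az) f(qz)` of the `q`-binomial series. -/
theorem qBinomial_functional_eq (a : ℂ) {q z : ℂ} (hq : ‖q‖ < 1) (hz : ‖z‖ < 1) :
    (1 - z) * ∑' n, qPoch a q n / qPoch q q n * z ^ n =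
      (1 - a * z) * ∑' n, qPoch a q n / qPoch q q n * (z * q) ^ n := by
  set c : ℕ → ℂ := fun n => qPoch a q n / qPoch q q n with hc
  obtain ⟨B, hB⟩ := exists_norm_le_of_tendsto (tendsto_qPoch_div a hq hq)
  have hs := summable_mul_pow_of_norm_le hB hz
  have hzq : ‖z * q‖ < 1 := by simpa using norm_mul_pow_lt_one hz hq 1
  have hs' := summable_mul_pow_of_norm_le hB hzq
  have hrec : ∀ n, c (n + 1) * z ^ (n + 1) - c (n + 1) * (z * q) ^ (n + 1) =
      z * (c n * z ^ n) - a * z * (c n * (z * q) ^ n) := by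
    intro n
    have h1 : c (n + 1) * (1 - q * q ^ n) = c n * (1 - a * q ^ n) := by
      simp only [hc, qPoch_succ]
      rw [mul_div_mul_comm, mul_assoc,
        div_mul_cancel₀ _ (one_sub_ne_zero_of_norm_lt_one (norm_mul_pow_lt_one hq hq n))]
    simp only [mul_pow, pow_succ]
    linear_combination z ^ n * z * h1
  have h1 := (hs.sub hs').tsum_eq_zero_add
  rw [hs.tsum_sub hs'] at h1
  simp only [pow_zero, sub_self, zero_add] at h1
  have h2 : ∑' n, (c (n + 1) * z ^ (n + 1) - c (n + 1) * (z * q) ^ (n + 1)) =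
      z * ∑' n, c n * z ^ n - a * z * ∑' n, c n * (z * q) ^ n := by
    rw [tsum_congr hrec, (hs.mul_left z).tsum_sub (hs'.mul_left (a * z)), tsum_mul_left,
      tsum_mul_left]
  change _ = ∑' n, (c (n + 1) * z ^ (n + 1) - c (n + 1) * (z * q) ^ (n + 1)) at h1
  rw [h2] at h1
  linear_combination h1

/-- The `q`-binomial theorem `∑ (a;q)_n / (q;q)_n zⁿ = (az;q)_∞ / (z;q)_∞`. -/
theorem hasSum_qBinomial (a : ℂ) {q z : ℂ} (hq : ‖q‖ < 1) (hz : ‖z‖ < 1) :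
    HasSum (fun n => qPoch a q n / qPoch q q n * z ^ n)
      (qPochInf (a * z) q / qPochInf z q) := by
  obtain ⟨B, hB⟩ := exists_norm_le_of_tendsto (tendsto_qPoch_div a hq hq)
  have hs := summable_mul_pow_of_norm_le hB hz
  set f : ℂ → ℂ := fun w => ∑' n, qPoch a q n / qPoch q q n * w ^ n with hf
  have hiter : ∀ N, qPoch z q N * f z = qPoch (a * z) q N * f (z * q ^ N) := by
    intro N
    induction N with
    | zero => simp [qPoch]
    | succ N ih =>
      have h := qBinomial_functional_eq a hq (norm_mul_pow_lt_one hz hq N)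
      rw [qPoch_succ, qPoch_succ, show z * q ^ (N + 1) = z * q ^ N * q by ring]
      simp only [hf] at ih ⊢
      linear_combination (1 - z * q ^ N) * ih + qPoch (a * z) q N * h
  have hlim : Tendsto (fun N => f (z * q ^ N)) atTop (𝓝 1) := by
    have h := tendsto_tsum_of_dominated_convergence
      (f := fun N k => qPoch a q k / qPoch q q k * (z * q ^ N) ^ k)
      (g := fun k => qPoch a q k / qPoch q q k * (0 : ℂ) ^ k) (𝓕 := atTop)
      (bound := fun k => B * ‖z‖ ^ k)
      ((summable_geometric_of_lt_one (norm_nonneg z) hz).mul_left B) ?_ ?_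
    · rwa [tsum_eq_single 0 (fun k hk => by simp [hk]), qPoch_zero, qPoch_zero, pow_zero, div_one,
        one_mul] at h
    · intro k
      have h0 : Tendsto (fun N : ℕ => z * q ^ N) atTop (𝓝 0) := by
        simpa using (tendsto_pow_atTop_nhds_zero_of_norm_lt_one hq).const_mul z
      exact (h0.pow k).const_mul _
    · refine Eventually.of_forall fun N k => ?_
      rw [norm_mul, norm_pow]
      refine mul_le_mul (hB k) (pow_le_pow_left₀ (norm_nonneg _) ?_ k) (by positivity)
        ((norm_nonneg _).trans (hB k))
      rw [norm_mul, norm_pow]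
      exact mul_le_of_le_one_right (norm_nonneg z) (pow_le_one₀ (norm_nonneg q) hq.le)
  have h1 := (tendsto_qPoch z q hq).mul_const (f z)
  have h2 := ((tendsto_qPoch (a * z) q hq).mul hlim).congr fun N => (hiter N).symm
  have h3 := tendsto_nhds_unique h1 h2
  have h4 : f z = qPochInf (a * z) q / qPochInf z q := by
    rw [eq_div_iff (qPochInf_ne_zero hz hq)]
    linear_combination h3
  rw [← h4]
  exact hs.hasSum

/-- The ratio `(-x;p)_n / (x;p)_n`, expanded in powers of `pⁿ` by the `q`-binomial theorem. -/
theorem hasSum_qPoch_neg_div {p x : ℂ} (hp : ‖p‖ < 1) (hx : ‖x‖ < 1) (n : ℕ) :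
    HasSum (fun m => qPoch (-1) p m / qPoch p p m * (-x * p ^ n) ^ m)
      (qPochInf x p / qPochInf (-x) p * (qPoch (-x) p n / qPoch x p n)) := by
  have hx' : ‖-x‖ < 1 := by simpa using hx
  have h := hasSum_qBinomial (-1) hp (norm_mul_pow_lt_one hx' hp n)
  convert h using 1
  rw [qPochInf_eq_qPoch_mul x hp n, qPochInf_eq_qPoch_mul (-x) hp n]
  have := qPoch_ne_zero hx hp n
  have := qPoch_ne_zero hx' hp n
  have := qPochInf_ne_zero (norm_mul_pow_lt_one hx hp n) hp
  have := qPochInf_ne_zero (norm_mul_pow_lt_one hx' hp n) hp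
  rw [show -1 * (-x * p ^ n) = x * p ^ n by ring]
  field_simp

/-- Interchange of the order of summation: for bounded `A` and `c`, the double series
`∑ A_m c_n y^m z^n p^{mn}` may be summed in either order. -/
theorem exists_hasSum_exchange {A c f g : ℕ → ℂ} {a b : ℝ} (hA : ∀ m, ‖A m‖ ≤ a)
    (hc : ∀ n, ‖c n‖ ≤ b) {y z p : ℂ} (hy : ‖y‖ < 1) (hz : ‖z‖ < 1) (hp : ‖p‖ ≤ 1)
    (hf : ∀ n, HasSum (fun m => A m * (y * p ^ n) ^ m) (f n))
    (hg : ∀ m, HasSum (fun n => c n * (z * p ^ m) ^ n) (g m)) :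
    ∃ s, HasSum (fun n => c n * z ^ n * f n) s ∧ HasSum (fun m => A m * y ^ m * g m) s := by
  set F : ℕ × ℕ → ℂ := fun x => c x.1 * z ^ x.1 * (A x.2 * (y * p ^ x.1) ^ x.2) with hF
  have ha : 0 ≤ a := (norm_nonneg _).trans (hA 0)
  have hb : 0 ≤ b := (norm_nonneg _).trans (hc 0)
  have hsum : Summable F := by
    have h1 := (summable_geometric_of_lt_one (norm_nonneg z) hz).mul_left b
    have h2 := (summable_geometric_of_lt_one (norm_nonneg y) hy).mul_left a
    refine Summable.of_norm_bounded
      (h1.mul_of_nonneg h2 (fun _ => by positivity) (fun _ => by positivity)) fun x => ?_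
    simp only [hF, norm_mul, norm_pow]
    refine mul_le_mul ?_ ?_ (by positivity) (by positivity)
    · exact mul_le_mul_of_nonneg_right (hc _) (by positivity)
    · refine mul_le_mul (hA _) (pow_le_pow_left₀ (by positivity) ?_ _) (by positivity) ha
      exact mul_le_of_le_one_right (norm_nonneg y) (pow_le_one₀ (norm_nonneg p) hp)
  refine ⟨∑' x, F x, ?_, ?_⟩
  · have h : ∀ n, HasSum (fun m => F (n, m)) (c n * z ^ n * f n) := fun n =>
      (hf n).mul_left (c n * z ^ n)
    exact hsum.hasSum.prod_fiberwise h
  · have h : ∀ m, HasSum (fun n => (F ∘ Equiv.prodComm ℕ ℕ) (m, n)) (A m * y ^ m * g m) := by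
      intro m
      have e : (fun n => (F ∘ Equiv.prodComm ℕ ℕ) (m, n)) =
          fun n => A m * y ^ m * (c n * (z * p ^ m) ^ n) := by
        funext n
        simp only [hF, Function.comp, Equiv.prodComm_apply, Prod.swap, mul_pow, ← pow_mul,
          mul_comm n m]
        ring
      rw [e]
      exact (hg m).mul_left _
    exact ((Equiv.prodComm ℕ ℕ).hasSum_iff.2 hsum.hasSum).prod_fiberwise h

/-! ### The little `q`-Jacobi polynomials as partial sums -/

/-- At `α = q^{-2n-1}`, `β = -1`, `x = -1` two of the shifted factorials cancel, and the little
`q`-Jacobi polynomial is a partial sum of the `q`-binomial series `∑ (-1;q)_k / (q;q)_k (-q)^k`. -/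
theorem littleQJacobi_eq_sum {q : ℂ} (hq0 : q ≠ 0) (hq : ‖q‖ < 1) (n : ℕ) :
    littleQJacobi (2 * n) (-1) (q ^ (-2 * (n : ℤ) - 1)) (-1) q =
      ∑ k ∈ Finset.range (2 * n + 1), qPoch (-1) q k / qPoch q q k * (-q) ^ k := by
  have hα : q ^ (-2 * (n : ℤ) - 1) * q = q ^ (-((2 * n : ℕ) : ℤ)) := by
    rw [← zpow_add_one₀ hq0]
    congr 1
    push_cast
    ring
  have hαβ : q ^ (-2 * (n : ℤ) - 1) * -1 * q ^ (2 * n + 1) = -1 := by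
    rw [pow_succ', mul_right_comm, ← mul_assoc, hα, zpow_neg, zpow_natCast,
      inv_mul_cancel₀ (pow_ne_zero _ hq0), one_mul]
  refine Finset.sum_congr rfl fun k hk => ?_
  have hne : qPoch (q ^ (-((2 * n : ℕ) : ℤ))) q k ≠ 0 := by
    refine Finset.prod_ne_zero_iff.2 fun j hj => ?_
    have hjk : 2 * n - j ≠ 0 := by
      have := Finset.mem_range.1 hj
      have := Finset.mem_range.1 hk
      omega
    rw [zpow_neg, zpow_natCast, show 2 * n = (2 * n - j) + j by omega, pow_add, mul_inv, mul_assoc,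
      inv_mul_cancel₀ (pow_ne_zero _ hq0), mul_one]
    intro h
    have h1 : q ^ (2 * n - j) = 1 := by
      rw [← inv_inv (q ^ (2 * n - j)), ← sub_eq_zero.1 h, inv_one]
    have h2 := norm_pow_lt_one hq hjk
    rw [h1, norm_one] at h2
    exact lt_irrefl _ h2
  rw [hα, hαβ, mul_comm (qPoch q q k), mul_div_mul_left _ _ hne]
  ring

/-! ### The series `∑ (q;q)_n / (-q²;q)_n zⁿ` -/

/-- The basic hypergeometric series `₂φ₁(q, q; -q²; q, z) = ∑ (q;q)_n / (-q²;q)_n zⁿ`. -/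
noncomputable def qRatioSeries (q z : ℂ) : ℂ := ∑' n, qPoch q q n / qPoch (-q ^ 2) q n * z ^ n

theorem norm_neg_sq_lt_one {q : ℂ} (hq : ‖q‖ < 1) : ‖-q ^ 2‖ < 1 := by
  rw [norm_neg]
  exact norm_pow_lt_one hq two_ne_zero

theorem hasSum_qRatioSeries {q z : ℂ} (hq : ‖q‖ < 1) (hz : ‖z‖ < 1) :
    HasSum (fun n => qPoch q q n / qPoch (-q ^ 2) q n * z ^ n) (qRatioSeries q z) := by
  obtain ⟨B, hB⟩ := exists_norm_le_of_tendsto (tendsto_qPoch_div q (norm_neg_sq_lt_one hq) hq)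
  exact (summable_mul_pow_of_norm_le hB hz).hasSum

theorem qPoch_ratio_succ {q : ℂ} (hq : ‖q‖ < 1) (n : ℕ) :
    (1 + q ^ (n + 2)) * (qPoch q q (n + 1) / qPoch (-q ^ 2) q (n + 1)) =
      (1 - q ^ (n + 1)) * (qPoch q q n / qPoch (-q ^ 2) q n) := by
  have h2 := one_sub_ne_zero_of_norm_lt_one (norm_mul_pow_lt_one (norm_neg_sq_lt_one hq) hq n)
  rw [qPoch_succ, qPoch_succ, mul_div_mul_comm,
    show 1 + q ^ (n + 2) = 1 - -q ^ 2 * q ^ n by ring, mul_left_comm, mul_div_cancel₀ _ h2]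
  ring

/-- The `q`-difference equation `(1 - z) G(z) = (1 + q) - q (1 + z) G(qz)`. -/
theorem qRatioSeries_functional_eq {q z : ℂ} (hq : ‖q‖ < 1) (hz : ‖z‖ < 1) :
    (1 - z) * qRatioSeries q z = (1 + q) - q * (1 + z) * qRatioSeries q (z * q) := by
  have hzq : ‖z * q‖ < 1 := by simpa using norm_mul_pow_lt_one hz hq 1
  have h1 := hasSum_qRatioSeries hq hz
  have h2 := hasSum_qRatioSeries hq hzq
  have h3 := h1.add (h2.mul_left q)
  have h4 := (h1.mul_left z).sub (h2.mul_left (z * q))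
  rw [← hasSum_nat_add_iff' 1] at h3
  have h5 := h3.unique (h4.congr_fun fun n => by
    have h := qPoch_ratio_succ hq n
    simp only [mul_pow, pow_succ] at h ⊢
    linear_combination z ^ n * z * h)
  simp only [Finset.range_one, Finset.sum_singleton, qPoch_zero, pow_zero, div_one, mul_one] at h5
  linear_combination h5

/-- The value at `z = q`, by telescoping; it plays the role of the limit of
`(1 - z) G(z)` at `z = 1`, where the `q`-difference equation degenerates. -/
theorem two_mul_qRatioSeries_self {q : ℂ} (hq : ‖q‖ < 1) :
    2 * q * qRatioSeries q q = (1 + q) * (1 - qPochInf q q / qPochInf (-q) q) := by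
  have hq2 := norm_neg_sq_lt_one hq
  have h1 := hasSum_qRatioSeries hq hq
  have h2 := h1
  rw [← hasSum_nat_add_iff' 1] at h2
  have h3 := ((h1.mul_left q).add (h2.mul_left q)).tendsto_sum_nat
  have h4 : Tendsto (fun N => 1 - qPoch q q N / qPoch (-q ^ 2) q N) atTop
      (𝓝 (1 - qPochInf q q / qPochInf (-q ^ 2) q)) :=
    (tendsto_qPoch_div q hq2 hq).const_sub 1
  have h5 := tendsto_nhds_unique h3 (h4.congr fun N => by
    have hN := Finset.sum_range_sub' (fun n => qPoch q q n / qPoch (-q ^ 2) q n) N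
    simp only [qPoch_zero, div_one] at hN
    rw [← hN]
    refine Finset.sum_congr rfl fun n _ => ?_
    have h := qPoch_ratio_succ hq n
    linear_combination -h)
  have h6 : qPochInf (-q) q = (1 + q) * qPochInf (-q ^ 2) q := by
    rw [qPochInf_eq_qPoch_mul (-q) hq 1]
    simp [qPoch, sq]
  have h7 := qPochInf_ne_zero hq2 hq
  have h8 := one_add_ne_zero_of_norm_lt_one hq
  have h9 : (1 + q) * (qPochInf q q / qPochInf (-q) q) = qPochInf q q / qPochInf (-q ^ 2) q := by
    rw [h6]
    field_simp
  simp only [Finset.range_one, Finset.sum_singleton, qPoch_zero, pow_zero, div_one, mul_one] at h5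
  linear_combination h5 + h9

theorem qPoch_neg_one_succ (q : ℂ) (n : ℕ) : qPoch (-1) q (n + 1) = 2 * qPoch (-q) q n := by
  rw [qPoch_succ']
  norm_num

/-- The first-order recursion given by the `q`-difference equation is solved along the points
`q, q², q³, …`; its inhomogeneous part sums to a partial sum of a `q`-binomial series. -/
theorem qRatioSeries_pow {q : ℂ} (hq : ‖q‖ < 1) (j : ℕ) :
    (-q) ^ j * qPoch (-q) q j * (2 * q) * qRatioSeries q (q * q ^ j) =
      (1 + q) * qPoch q q j *
        (∑ k ∈ Finset.range (j + 1), qPoch (-1) q k / qPoch q q k * (-q) ^ k -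
          qPochInf q q / qPochInf (-q) q) := by
  induction j with
  | zero =>
    have h := two_mul_qRatioSeries_self hq
    simp only [pow_zero, mul_one, qPoch_zero, zero_add, Finset.range_one, Finset.sum_singleton,
      div_one, one_mul]
    linear_combination h
  | succ j ih =>
    have h := qRatioSeries_functional_eq hq (norm_mul_pow_lt_one hq hq j)
    rw [show q * q ^ j * q = q * q ^ (j + 1) by ring] at h
    rw [Finset.sum_range_succ, qPoch_neg_one_succ, qPoch_succ (-q)]
    have h1 : qPoch q q (j + 1) * (2 * qPoch (-q) q j / qPoch q q (j + 1)) = 2 * qPoch (-q) q j :=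
      mul_div_cancel₀ _ (qPoch_ne_zero hq hq _)
    have h2 := qPoch_succ q q j
    generalize hS : ∑ k ∈ Finset.range (j + 1), qPoch (-1) q k / qPoch q q k * (-q) ^ k = S at ih ⊢
    generalize 2 * qPoch (-q) q j / qPoch q q (j + 1) = R at h1 ⊢
    linear_combination (1 - q * q ^ j) * ih - (1 + q) * (-q) ^ (j + 1) * h1 -
      (1 + q) * (S - qPochInf q q / qPochInf (-q) q) * h2 +
      (-q) ^ j * qPoch (-q) q j * (2 * q) * (-1 : ℂ) * h

/-! ### The two transformations -/

/-- `(-1;q²)_n (q;q)_{2n} / ((q²;q²)_n (-q;q)_{2n})` simplifies. -/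
theorem qPoch_coeff_simplify {q : ℂ} (hq : ‖q‖ < 1) (n : ℕ) :
    qPoch (-1) (q ^ 2) n / qPoch (q ^ 2) (q ^ 2) n *
        (qPoch q q (2 * n) / qPoch (-q) q (2 * n)) =
      2 * (qPoch q (q ^ 2) n / (qPoch (-q) (q ^ 2) n * (1 + q ^ (2 * n)))) := by
  have hq2 := norm_pow_lt_one hq two_ne_zero
  have hqn : ‖-q‖ < 1 := by simpa using hq
  have h1 := qPoch_succ (-1) (q ^ 2) n
  rw [qPoch_neg_one_succ, ← pow_mul] at h1
  have e1 := qPoch_two_mul q q n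
  have e2 := qPoch_two_mul (-q) q n
  rw [show q * q = q ^ 2 by ring] at e1
  rw [show -q * q = -q ^ 2 by ring] at e2
  rw [e1, e2]
  have n1 := qPoch_ne_zero hq2 hq2 n
  have n2 := qPoch_ne_zero (norm_neg_sq_lt_one hq) hq2 n
  have n3 := qPoch_ne_zero hqn hq2 n
  have n4 : 1 + q ^ (2 * n) ≠ 0 := by
    rcases n with _ | n
    · norm_num
    · exact one_add_ne_zero_of_norm_lt_one (norm_pow_lt_one hq (by omega))
  generalize qPoch (-1) (q ^ 2) n = a at h1 ⊢
  generalize qPoch (-q ^ 2) (q ^ 2) n = b at h1 n2 ⊢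
  generalize q ^ (2 * n) = w at h1 n4 ⊢
  field_simp
  linear_combination -qPoch q (q ^ 2) n * h1

theorem exists_norm_weight_le {q : ℂ} (hq : ‖q‖ < 1) :
    ∃ B, ∀ n, ‖qPoch q (q ^ 2) n / (qPoch (-q) (q ^ 2) n * (1 + q ^ (2 * n)))‖ ≤ B := by
  have hq2 := norm_pow_lt_one hq two_ne_zero
  have hqn : ‖-q‖ < 1 := by simpa using hq
  have h : Tendsto (fun n : ℕ => 1 + q ^ (2 * n)) atTop (𝓝 (1 + 0)) := by
    simp only [pow_mul]
    exact (tendsto_pow_atTop_nhds_zero_of_norm_lt_one hq2).const_add 1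
  exact exists_norm_le_of_tendsto (((tendsto_qPoch_div q hqn hq2).div h (by norm_num)).congr
    fun n => div_div _ _ _)

theorem summable_weight {q : ℂ} (hq : ‖q‖ < 1) :
    Summable fun n : ℕ =>
      qPoch q (q ^ 2) n * (-q) ^ n / (qPoch (-q) (q ^ 2) n * (1 + q ^ (2 * n))) := by
  obtain ⟨B, hB⟩ := exists_norm_weight_le hq
  have hqn : ‖-q‖ < 1 := by simpa using hq
  exact (summable_mul_pow_of_norm_le hB hqn).congr fun n => by ring

theorem summable_weight_mul_littleQJacobi {q : ℂ} (hq0 : q ≠ 0) (hq : ‖q‖ < 1) :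
    Summable fun n : ℕ =>
      qPoch q (q ^ 2) n * (-q) ^ n / (qPoch (-q) (q ^ 2) n * (1 + q ^ (2 * n))) *
        littleQJacobi (2 * n) (-1) (q ^ (-2 * (n : ℤ) - 1)) (-1) q := by
  obtain ⟨B, hB⟩ := exists_norm_weight_le hq
  have hqn : ‖-q‖ < 1 := by simpa using hq
  obtain ⟨C, hC⟩ := exists_norm_le_of_tendsto (hasSum_qBinomial (-1) hq hqn).tendsto_sum_nat
  have hBC : ∀ n, ‖qPoch q (q ^ 2) n / (qPoch (-q) (q ^ 2) n * (1 + q ^ (2 * n))) *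
      littleQJacobi (2 * n) (-1) (q ^ (-2 * (n : ℤ) - 1)) (-1) q‖ ≤ B * C := by
    intro n
    rw [norm_mul, littleQJacobi_eq_sum hq0 hq]
    exact mul_le_mul (hB n) (hC _) (norm_nonneg _) ((norm_nonneg _).trans (hB n))
  exact (summable_mul_pow_of_norm_le hBC hqn).congr fun n => by ring

/-- Evaluation of `∑ (-1;q)_n (-q;q²)_n / ((q;q²)_n (q;q)_n) qⁿ`: expand `(-q;q²)_n / (q;q²)_n`
in powers of `q^{2n}` and sum over `n` first, by the `q`-binomial theorem. -/
theorem hasSum_qPoch_transform {q : ℂ} (hq : ‖q‖ < 1) :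
    HasSum (fun n : ℕ =>
        qPoch (-1) q n * qPoch (-q) (q ^ 2) n / (qPoch q (q ^ 2) n * qPoch q q n) * q ^ n)
      (2 * (qPochInf (-q) q / qPochInf q q) * (qPochInf (-q) (q ^ 2) / qPochInf q (q ^ 2)) *
        ∑' n : ℕ, qPoch q (q ^ 2) n * (-q) ^ n /
          (qPoch (-q) (q ^ 2) n * (1 + q ^ (2 * n)))) := by
  have hq2 := norm_pow_lt_one hq two_ne_zero
  have hqn : ‖-q‖ < 1 := by simpa using hq
  obtain ⟨a, ha⟩ := exists_norm_le_of_tendsto (tendsto_qPoch_div (-1) hq2 hq2)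
  obtain ⟨b, hb⟩ := exists_norm_le_of_tendsto (tendsto_qPoch_div (-1) hq hq)
  obtain ⟨s, h1, h2⟩ := exists_hasSum_exchange ha hb hqn hq hq2.le
    (fun n => hasSum_qPoch_neg_div hq2 hq n)
    (fun m => hasSum_qBinomial (-1) hq (norm_mul_pow_lt_one hq hq2 m))
  have hI := qPochInf_ne_zero hq hq
  have hI' := qPochInf_ne_zero hqn hq
  have hJ := qPochInf_ne_zero hq hq2
  have hJ' := qPochInf_ne_zero hqn hq2
  have h3 : HasSum (fun m => 2 * (qPochInf (-q) q / qPochInf q q) *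
      (qPoch q (q ^ 2) m * (-q) ^ m / (qPoch (-q) (q ^ 2) m * (1 + q ^ (2 * m))))) s := by
    refine h2.congr_fun fun m => ?_
    have hm : ‖q * q ^ (2 * m)‖ < 1 := norm_mul_pow_lt_one hq hq _
    have e1 := qPochInf_eq_qPoch_mul q hq (2 * m)
    have e2 := qPochInf_eq_qPoch_mul (-q) hq (2 * m)
    have e3 := qPoch_coeff_simplify hq m
    rw [← pow_mul, show -1 * (q * q ^ (2 * m)) = -q * q ^ (2 * m) by ring]
    have e4 : qPochInf (-q * q ^ (2 * m)) q / qPochInf (q * q ^ (2 * m)) q =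
        qPochInf (-q) q / qPochInf q q * (qPoch q q (2 * m) / qPoch (-q) q (2 * m)) := by
      have := qPoch_ne_zero hq hq (2 * m)
      have := qPoch_ne_zero hqn hq (2 * m)
      have := qPochInf_ne_zero hm hq
      rw [e1, e2]
      field_simp
    rw [e4]
    linear_combination (-(-q) ^ m * (qPochInf (-q) q / qPochInf q q)) * e3
  have h4 := ((summable_weight hq).hasSum.mul_left (2 * (qPochInf (-q) q / qPochInf q q))).unique h3
  rw [mul_right_comm, h4, mul_comm]
  refine (h1.mul_left (qPochInf (-q) (q ^ 2) / qPochInf q (q ^ 2))).congr_fun fun n => ?_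
  field_simp

/-- Evaluation of `∑ qⁿ (-q³;q²)_n (q;q)_n / ((q³;q²)_n (-q²;q)_n)`: expand
`(-q³;q²)_n / (q³;q²)_n` in powers of `q^{2n}` and sum over `n` first, by the closed form
of `∑ (q;q)_n / (-q²;q)_n q^{(2m+1)n}`. -/
theorem hasSum_omega_transform {q : ℂ} (hq0 : q ≠ 0) (hq : ‖q‖ < 1) :
    HasSum (fun n : ℕ =>
        q ^ n * qPoch (-q ^ 3) (q ^ 2) n * qPoch q q n /
          (qPoch (q ^ 3) (q ^ 2) n * qPoch (-q ^ 2) q n))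
      (1 / q * (qPochInf (-q) (q ^ 2) / qPochInf (q ^ 3) (q ^ 2)) *
        (∑' n : ℕ, qPoch q (q ^ 2) n * (-q) ^ n /
            (qPoch (-q) (q ^ 2) n * (1 + q ^ (2 * n))) *
              littleQJacobi (2 * n) (-1) (q ^ (-2 * (n : ℤ) - 1)) (-1) q -
          qPochInf q q / qPochInf (-q) q *
            ∑' n : ℕ, qPoch q (q ^ 2) n * (-q) ^ n /
              (qPoch (-q) (q ^ 2) n * (1 + q ^ (2 * n))))) := by
  have hq2 := norm_pow_lt_one hq two_ne_zero
  have hq3 := norm_pow_lt_one hq three_ne_zero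
  have hqn : ‖-q‖ < 1 := by simpa using hq
  have hq3n : ‖-q ^ 3‖ < 1 := by simpa using hq3
  obtain ⟨a, ha⟩ := exists_norm_le_of_tendsto (tendsto_qPoch_div (-1) hq2 hq2)
  obtain ⟨b, hb⟩ := exists_norm_le_of_tendsto (tendsto_qPoch_div q (norm_neg_sq_lt_one hq) hq)
  obtain ⟨s, h1, h2⟩ := exists_hasSum_exchange ha hb hq3n hq hq2.le
    (fun n => hasSum_qPoch_neg_div hq2 hq3 n)
    (fun m => hasSum_qRatioSeries hq (norm_mul_pow_lt_one hq hq2 m))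
  have hJ := qPochInf_ne_zero hq3 hq2
  have hJ' := qPochInf_ne_zero hq3n hq2
  set E := qPochInf q q / qPochInf (-q) q with hE
  have h3 := ((summable_weight_mul_littleQJacobi hq0 hq).hasSum.sub
    ((summable_weight hq).hasSum.mul_left E)).mul_left ((1 + q) / q)
  have h4 := h3.unique (h2.congr_fun fun m => by
    have e1 := qRatioSeries_pow hq (2 * m)
    have e3 := qPoch_coeff_simplify hq m
    rw [littleQJacobi_eq_sum hq0 hq]
    rw [← hE] at e1
    have n1 := qPoch_ne_zero hqn hq (2 * m)
    have n2 : (-q) ^ (2 * m) ≠ 0 := pow_ne_zero _ (neg_ne_zero.2 hq0)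
    generalize ∑ k ∈ Finset.range (2 * m + 1), qPoch (-1) q k / qPoch q q k * (-q) ^ k = S at e1 ⊢
    have e4 : qRatioSeries q (q * (q ^ 2) ^ m) * (-q) ^ (2 * m) =
        (1 + q) / (2 * q) * (qPoch q q (2 * m) / qPoch (-q) q (2 * m)) * (S - E) := by
      rw [← pow_mul]
      field_simp
      linear_combination e1
    have e5 : (-q ^ 3) ^ m = (-q) ^ m * (-q) ^ (2 * m) := by
      rw [pow_mul, ← mul_pow]
      congr 1
      ring
    rw [e5]
    linear_combination (-(qPoch (-1) (q ^ 2) m / qPoch (q ^ 2) (q ^ 2) m) * (-q) ^ m) * e4 -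
      (1 + q) / (2 * q) * (S - E) * (-q) ^ m * e3)
  have h5 : qPochInf (-q) (q ^ 2) = (1 + q) * qPochInf (-q ^ 3) (q ^ 2) := by
    rw [qPochInf_eq_qPoch_mul (-q) hq2 1, qPoch_succ, qPoch_zero,
      show -q * (q ^ 2) ^ 1 = -q ^ 3 by ring]
    ring
  have h6 : 1 / q * (qPochInf (-q) (q ^ 2) / qPochInf (q ^ 3) (q ^ 2)) =
      (qPochInf (-q ^ 3) (q ^ 2) / qPochInf (q ^ 3) (q ^ 2)) * ((1 + q) / q) := by
    rw [h5]
    field_simp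
  rw [h6, mul_assoc, h4]
  refine (h1.mul_left (qPochInf (-q ^ 3) (q ^ 2) / qPochInf (q ^ 3) (q ^ 2))).congr_fun fun n => ?_
  field_simp

/-! ### Evaluating partition generating functions -/

theorem PowerSeries.hasSum_coeff_mul {F G : PowerSeries ℝ} {q a b : ℂ}
    (hF : HasSum (fun n => (F.coeff n : ℂ) * q ^ n) a)
    (hG : HasSum (fun n => (G.coeff n : ℂ) * q ^ n) b) :
    HasSum (fun n => ((F * G).coeff n : ℂ) * q ^ n) (a * b) := by
  have h := (summable_norm_sum_mul_antidiagonal_of_summable_norm hF.summable.norm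
    hG.summable.norm).of_norm.hasSum
  rw [← tsum_mul_tsum_eq_tsum_sum_antidiagonal_of_summable_norm hF.summable.norm
    hG.summable.norm, hF.tsum_eq, hG.tsum_eq] at h
  refine h.congr_fun fun n => ?_
  rw [PowerSeries.coeff_mul, Complex.ofReal_sum, Finset.sum_mul]
  refine Finset.sum_congr rfl fun x hx => ?_
  rw [← Finset.HasAntidiagonal.mem_antidiagonal.1 hx, Complex.ofReal_mul, pow_add]
  ring

theorem PowerSeries.hasSum_coeff_prod {ι : Type*} (s : Finset ι) {F : ι → PowerSeries ℝ} {q : ℂ}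
    {a : ι → ℂ} (h : ∀ i ∈ s, HasSum (fun n => ((F i).coeff n : ℂ) * q ^ n) (a i)) :
    HasSum (fun n => ((∏ i ∈ s, F i).coeff n : ℂ) * q ^ n) (∏ i ∈ s, a i) := by
  classical
  induction s using Finset.induction_on with
  | empty =>
    simp only [Finset.prod_empty]
    convert hasSum_single (f := fun n => (((1 : PowerSeries ℝ).coeff n : ℝ) : ℂ) * q ^ n) 0
      (fun n hn => by simp [PowerSeries.coeff_one, hn]) using 1
    simp
  | insert i s hi ih =>
    rw [Finset.prod_insert hi, Finset.prod_insert hi]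
    exact PowerSeries.hasSum_coeff_mul (h i (Finset.mem_insert_self _ _))
      (ih fun j hj => h j (Finset.mem_insert_of_mem hj))

open scoped PowerSeries.WithPiTopology in
/-- The local factor of a partition generating function whose weight does not depend on the
multiplicity of the part. -/
theorem hasSum_coeff_genFun_factor (t : ℝ) (i : ℕ) {q : ℂ} (hq : ‖q‖ < 1) :
    HasSum (fun n => (((1 + ∑' j : ℕ, t • (PowerSeries.X : PowerSeries ℝ) ^ ((i + 1) * (j + 1)) :
        PowerSeries ℝ).coeff n : ℝ) : ℂ) * q ^ n)
      (1 + t * (q ^ (i + 1) / (1 - q ^ (i + 1)))) := by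
  have hs : Summable fun j : ℕ => t • (PowerSeries.X : PowerSeries ℝ) ^ ((i + 1) * (j + 1)) :=
    Nat.Partition.summable_genFun_term (fun _ _ => t) i
  have hcoeff : ∀ n, (∑' j : ℕ, t • (PowerSeries.X : PowerSeries ℝ) ^ ((i + 1) * (j + 1))).coeff n
      = ∑' j : ℕ, if n = (i + 1) * (j + 1) then t else 0 := by
    intro n
    rw [hs.map_tsum _ (PowerSeries.WithPiTopology.continuous_coeff _ _)]
    refine tsum_congr fun j => ?_
    simp [PowerSeries.coeff_X_pow]
  have hinj : Function.Injective fun j : ℕ => (i + 1) * (j + 1) := fun a b h => by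
    simpa using h
  have hqi : ‖q ^ (i + 1)‖ < 1 := norm_pow_lt_one hq (Nat.succ_ne_zero i)
  have h1 : HasSum (fun n => (((∑' j : ℕ, t • (PowerSeries.X : PowerSeries ℝ) ^
      ((i + 1) * (j + 1)) : PowerSeries ℝ).coeff n : ℝ) : ℂ) * q ^ n)
      (t * (q ^ (i + 1) / (1 - q ^ (i + 1)))) := by
    refine (hinj.hasSum_iff fun n hn => ?_).1 ?_
    · have h2 : ∀ j : ℕ, (if n = (i + 1) * (j + 1) then t else 0) = 0 := fun j =>
        if_neg fun h => hn ⟨j, h.symm⟩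
      simp [hcoeff, h2]
    · have h2 := ((hasSum_geometric_of_norm_lt_one hqi).mul_left (t * q ^ (i + 1)))
      rw [mul_assoc, ← div_eq_mul_inv] at h2
      refine h2.congr_fun fun j => ?_
      rw [Function.comp, hcoeff, tsum_eq_single j]
      · simp only [if_true]
        rw [← pow_mul, mul_assoc, ← pow_add]
        congr 2
        ring
      · intro k hk
        rw [if_neg]
        intro h
        exact hk (hinj h).symm
  have h0 : HasSum (fun n => (((1 : PowerSeries ℝ).coeff n : ℝ) : ℂ) * q ^ n) 1 := by
    convert hasSum_single (f := fun n => (((1 : PowerSeries ℝ).coeff n : ℝ) : ℂ) * q ^ n) 0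
      (fun n hn => by simp [PowerSeries.coeff_one, hn]) using 1
    simp
  refine (h0.add h1).congr_fun fun n => ?_
  rw [map_add, Complex.ofReal_add, add_mul]

/-- The sum, over the partitions `p` of `n`, of the product of `t i` over the part sizes `i` of
`p`. -/
noncomputable def partitionWeight (t : ℕ → ℝ) (n : ℕ) : ℝ :=
  ∑ p : n.Partition, ∏ i ∈ p.parts.toFinset, t i

theorem partitionWeight_eq_coeff (t : ℕ → ℝ) (n : ℕ) :
    partitionWeight t n = (Nat.Partition.genFun fun i _ => t i).coeff n := by
  rw [Nat.Partition.coeff_genFun]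
  rfl

theorem partitionWeight_nonneg {t : ℕ → ℝ} (ht : ∀ i, 0 ≤ t i) (n : ℕ) :
    0 ≤ partitionWeight t n :=
  Finset.sum_nonneg fun _ _ => Finset.prod_nonneg fun i _ => ht i

open scoped PowerSeries.WithPiTopology in
/-- Partitions into parts at most `N`: the generating function is a finite product. -/
theorem hasSum_partitionWeight_truncated (t : ℕ → ℝ) (N : ℕ) {q : ℂ} (hq : ‖q‖ < 1) :
    HasSum (fun n => (partitionWeight (fun i => if i ≤ N then t i else 0) n : ℂ) * q ^ n)
      (∏ i ∈ Finset.range N, (1 + t (i + 1) * (q ^ (i + 1) / (1 - q ^ (i + 1))))) := by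
  have h1 := Nat.Partition.hasProd_genFun (R := ℝ) fun i _ => if i ≤ N then t i else 0
  have h2 := h1.unique (hasProd_prod_of_ne_finset_one (s := Finset.range N) fun i hi => by
    rw [Finset.mem_range, not_lt] at hi
    have : ¬ i + 1 ≤ N := by omega
    simp [this])
  simp only [partitionWeight_eq_coeff, h2]
  refine PowerSeries.hasSum_coeff_prod _ fun i hi => ?_
  have : i + 1 ≤ N := Finset.mem_range.1 hi
  simp only [this, if_true]
  exact hasSum_coeff_genFun_factor _ _ hq

theorem partitionWeight_truncated_le {t : ℕ → ℝ} (ht : ∀ i, 0 ≤ t i) (N n : ℕ) :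
    partitionWeight (fun i => if i ≤ N then t i else 0) n ≤ partitionWeight t n := by
  refine Finset.sum_le_sum fun p _ => Finset.prod_le_prod (fun i _ => ?_) fun i _ => ?_
  · split_ifs
    exacts [ht i, le_rfl]
  · split_ifs
    exacts [le_rfl, ht i]

theorem partitionWeight_truncated_eq (t : ℕ → ℝ) {N n : ℕ} (h : n ≤ N) :
    partitionWeight (fun i => if i ≤ N then t i else 0) n = partitionWeight t n := by
  refine Finset.sum_congr rfl fun p _ => Finset.prod_congr rfl fun i hi => ?_
  exact if_pos ((Nat.Partition.le_of_mem_parts (Multiset.mem_toFinset.1 hi)).trans h)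

theorem summable_partitionWeight {t : ℕ → ℝ} (ht : ∀ i, 0 ≤ t i) (ht2 : ∀ i, t i ≤ 2) {q : ℂ}
    (hq : ‖q‖ < 1) : Summable fun n => (partitionWeight t n : ℂ) * q ^ n := by
  have hr0 := norm_nonneg q
  have hu : Summable fun i : ℕ => 2 * (‖q‖ ^ (i + 1) / (1 - ‖q‖)) :=
    (((summable_nat_add_iff 1).2 (summable_geometric_of_lt_one hr0 hq)).div_const _).mul_left 2
  have hu0 : ∀ i : ℕ, 0 ≤ 2 * (‖q‖ ^ (i + 1) / (1 - ‖q‖)) := fun i => by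
    have : 0 < 1 - ‖q‖ := sub_pos.2 hq
    positivity
  refine Summable.of_norm (summable_of_sum_range_le
    (c := Real.exp (∑' i : ℕ, 2 * (‖q‖ ^ (i + 1) / (1 - ‖q‖)))) (fun _ => norm_nonneg _) fun N => ?_)
  have hr : ‖(‖q‖ : ℂ)‖ < 1 := by simpa using hq
  have h := hasSum_partitionWeight_truncated t N hr
  have h' : HasSum (fun n => partitionWeight (fun i => if i ≤ N then t i else 0) n * ‖q‖ ^ n)
      (∏ i ∈ Finset.range N, (1 + t (i + 1) * (‖q‖ ^ (i + 1) / (1 - ‖q‖ ^ (i + 1))))) := by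
    exact_mod_cast h
  calc ∑ n ∈ Finset.range N, ‖(partitionWeight t n : ℂ) * q ^ n‖
      = ∑ n ∈ Finset.range N,
          partitionWeight (fun i => if i ≤ N then t i else 0) n * ‖q‖ ^ n := by
        refine Finset.sum_congr rfl fun n hn => ?_
        rw [partitionWeight_truncated_eq t (Finset.mem_range.1 hn).le, norm_mul, norm_pow,
          Complex.norm_real, Real.norm_of_nonneg (partitionWeight_nonneg ht n)]
    _ ≤ _ := by
        refine sum_le_hasSum _ (fun n _ => mul_nonneg (partitionWeight_nonneg (fun i => ?_) n)
          (by positivity)) h'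
        split_ifs
        exacts [ht i, le_rfl]
    _ ≤ ∏ i ∈ Finset.range N, (1 + 2 * (‖q‖ ^ (i + 1) / (1 - ‖q‖))) := by
        have hd : ∀ i : ℕ, 0 < 1 - ‖q‖ := fun _ => sub_pos.2 hq
        have hd' : ∀ i : ℕ, 1 - ‖q‖ ≤ 1 - ‖q‖ ^ (i + 1) := fun i =>
          sub_le_sub_left (pow_le_of_le_one hr0 hq.le (Nat.succ_ne_zero i)) 1
        refine Finset.prod_le_prod (fun i _ => ?_) fun i _ => ?_
        · have := (hd i).trans_le (hd' i)
          have := ht (i + 1)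
          positivity
        · have := (hd i).trans_le (hd' i)
          have := ht (i + 1)
          refine add_le_add_right (mul_le_mul (ht2 _) ?_ (by positivity) zero_le_two) 1
          exact div_le_div_of_nonneg_left (by positivity) (hd i) (hd' i)
    _ ≤ ∏ i ∈ Finset.range N, Real.exp (2 * (‖q‖ ^ (i + 1) / (1 - ‖q‖))) := by
        refine Finset.prod_le_prod (fun i _ => add_nonneg zero_le_one (hu0 i)) fun i _ => ?_
        rw [add_comm]
        exact Real.add_one_le_exp _
    _ ≤ _ := by
        rw [← Real.exp_sum]
        exact Real.exp_le_exp.2 (hu.sum_le_tsum _ fun i _ => hu0 i)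

theorem tendsto_prod_partitionWeight {t : ℕ → ℝ} (ht : ∀ i, 0 ≤ t i) (ht2 : ∀ i, t i ≤ 2) {q : ℂ}
    (hq : ‖q‖ < 1) :
    Tendsto (fun N => ∏ i ∈ Finset.range N,
        (1 + (t (i + 1) : ℂ) * (q ^ (i + 1) / (1 - q ^ (i + 1))))) atTop
      (𝓝 (∑' n, (partitionWeight t n : ℂ) * q ^ n)) := by
  refine (tendsto_tsum_of_dominated_convergence (summable_partitionWeight ht ht2 hq).norm
    (fun n => ?_) (Eventually.of_forall fun N n => ?_)).congr fun N =>
      (hasSum_partitionWeight_truncated t N hq).tsum_eq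
  · refine tendsto_const_nhds.congr' ?_
    filter_upwards [eventually_ge_atTop n] with N hN
    rw [partitionWeight_truncated_eq t hN]
  · rw [norm_mul, norm_mul, Complex.norm_real, Complex.norm_real,
      Real.norm_of_nonneg (partitionWeight_nonneg ht n), Real.norm_of_nonneg]
    · exact mul_le_mul_of_nonneg_right (partitionWeight_truncated_le ht N n) (norm_nonneg _)
    · refine partitionWeight_nonneg (fun i => ?_) n
      split_ifs
      exacts [ht i, le_rfl]

/-! ### Overpartitions counted by their smallest part -/

/-- The number of ways to overline a part size `i` of an overpartition with overlined smallest part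
`m` and all odd parts less than `2m`; it is `0` if `i` is not allowed as a part. -/
noncomputable def omegaFactor (m i : ℕ) : ℝ :=
  if i = m then 1 else if m < i ∧ (Odd i → i < 2 * m) then 2 else 0

/-- As `omegaFactor`, but with the part `m` itself forbidden. -/
noncomputable def omegaFactorAbove (m i : ℕ) : ℝ :=
  if i = m then 0 else omegaFactor m i

/-- For `m ≥ 1`, the number of overpartitions of `n` whose smallest part is `m`, overlined, and
whose odd parts are less than `2m`: those in which the part `m` is allowed, minus those
in which it is absent. -/
noncomputable def omegaCount (m n : ℕ) : ℝ :=
  partitionWeight (omegaFactor m) n - partitionWeight (omegaFactorAbove m) n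

theorem omegaFactor_nonneg (m i : ℕ) : 0 ≤ omegaFactor m i := by
  unfold omegaFactor
  split_ifs <;> norm_num

theorem omegaFactor_le_two (m i : ℕ) : omegaFactor m i ≤ 2 := by
  unfold omegaFactor
  split_ifs <;> norm_num

theorem omegaFactorAbove_nonneg (m i : ℕ) : 0 ≤ omegaFactorAbove m i := by
  unfold omegaFactorAbove
  split_ifs
  exacts [le_rfl, omegaFactor_nonneg m i]

theorem omegaFactorAbove_le (m i : ℕ) : omegaFactorAbove m i ≤ omegaFactor m i := by
  unfold omegaFactorAbove
  split_ifs
  exacts [omegaFactor_nonneg m i, le_rfl]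

theorem omegaCount_nonneg (m n : ℕ) : 0 ≤ omegaCount m n :=
  sub_nonneg.2 <| Finset.sum_le_sum fun _ _ =>
    Finset.prod_le_prod (fun i _ => omegaFactorAbove_nonneg m i) fun i _ => omegaFactorAbove_le m i

/-- `m` is the least element of `D`, and all odd elements of `D` are less than `2m`. -/
def IsOmegaMin (D : Finset ℕ) (m : ℕ) : Prop :=
  m ∈ D ∧ ∀ i ∈ D, m ≤ i ∧ (Odd i → i < 2 * m)

theorem IsOmegaMin.unique {D : Finset ℕ} {m m' : ℕ} (h : IsOmegaMin D m) (h' : IsOmegaMin D m') :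
    m = m' :=
  le_antisymm (h.2 _ h'.1).1 (h'.2 _ h.1).1

theorem prod_omegaFactor_sub_of_isOmegaMin {D : Finset ℕ} {m : ℕ} (h : IsOmegaMin D m) :
    ∏ i ∈ D, omegaFactor m i - ∏ i ∈ D, omegaFactorAbove m i = 2 ^ (D.card - 1) := by
  have h0 : ∏ i ∈ D, omegaFactorAbove m i = 0 :=
    Finset.prod_eq_zero h.1 (by simp [omegaFactorAbove])
  rw [h0, sub_zero, ← Finset.mul_prod_erase D _ h.1, ← Finset.card_erase_of_mem h.1]
  have h1 : omegaFactor m m = 1 := by simp [omegaFactor]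
  rw [h1, one_mul]
  refine Finset.prod_eq_pow_card fun i hi => ?_
  have hi' := Finset.mem_erase.1 hi
  have h2 := h.2 i hi'.2
  simp only [omegaFactor]
  rw [if_neg hi'.1, if_pos ⟨lt_of_le_of_ne h2.1 (Ne.symm hi'.1), h2.2⟩]

theorem prod_omegaFactor_sub_of_not_isOmegaMin {D : Finset ℕ} {m : ℕ} (hm : m ≠ 0)
    (h : ¬ IsOmegaMin D m) :
    ∏ i ∈ D, omegaFactor m i - ∏ i ∈ D, omegaFactorAbove m i = 0 := by
  by_cases hD : m ∈ D
  · have h1 : ∃ i ∈ D, ¬ (m ≤ i ∧ (Odd i → i < 2 * m)) := by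
      by_contra! h2
      exact h ⟨hD, h2⟩
    obtain ⟨i, hi, h2⟩ := h1
    have him : i ≠ m := by
      rintro rfl
      exact h2 ⟨le_rfl, fun _ => by omega⟩
    have h3 : omegaFactor m i = 0 := by
      simp only [omegaFactor]
      rw [if_neg him, if_neg fun h4 => h2 ⟨h4.1.le, h4.2⟩]
    have h4 : omegaFactorAbove m i = 0 := by
      simp only [omegaFactorAbove]
      rw [if_neg him, h3]
    rw [Finset.prod_eq_zero hi h3, Finset.prod_eq_zero hi h4, sub_zero]
  · rw [sub_eq_zero]
    refine Finset.prod_congr rfl fun i hi => ?_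
    simp only [omegaFactorAbove]
    rw [if_neg fun h1 : i = m => hD (h1 ▸ hi)]

/-- The possible sets of overlined part sizes for a given set `D` of part sizes, counted by
summation over the smallest part `k + 1`. -/
theorem hasSum_prod_omegaFactor_sub {D : Finset ℕ} (hD : 0 ∉ D) :
    HasSum (fun k => ∏ i ∈ D, omegaFactor (k + 1) i - ∏ i ∈ D, omegaFactorAbove (k + 1) i)
      (Nat.card {S : Finset ℕ // S ⊆ D ∧ ∃ m ∈ S, IsOmegaMin D m} : ℝ) := by
  by_cases h : ∃ m, IsOmegaMin D m
  · obtain ⟨m, hm⟩ := h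
    have hm0 : m - 1 + 1 = m := by
      have : m ≠ 0 := fun h0 => hD (h0 ▸ hm.1)
      omega
    have hcard : (Nat.card {S : Finset ℕ // S ⊆ D ∧ ∃ m ∈ S, IsOmegaMin D m} : ℝ) =
        ∏ i ∈ D, omegaFactor (m - 1 + 1) i - ∏ i ∈ D, omegaFactorAbove (m - 1 + 1) i := by
      rw [hm0, prod_omegaFactor_sub_of_isOmegaMin hm]
      have h1 : ∀ S : Finset ℕ, (S ⊆ D ∧ ∃ m ∈ S, IsOmegaMin D m) ↔ S ∈ Finset.Icc {m} D := by
        intro S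
        rw [Finset.mem_Icc, Finset.singleton_subset_iff, and_comm]
        refine and_congr_left fun _ => ⟨?_, fun hS => ⟨m, hS, hm⟩⟩
        rintro ⟨m', hS, hm'⟩
        rwa [hm.unique hm']
      rw [Nat.card_congr (Equiv.subtypeEquivRight h1), Nat.card_eq_fintype_card,
        Fintype.card_coe, Finset.card_Icc_finset (Finset.singleton_subset_iff.2 hm.1),
        Finset.card_singleton]
      push_cast
      rfl
    rw [hcard]
    refine hasSum_single (m - 1) fun k hk => ?_
    refine prod_omegaFactor_sub_of_not_isOmegaMin (Nat.succ_ne_zero k) fun h1 => hk ?_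
    have := h1.unique hm
    omega
  · have : IsEmpty {S : Finset ℕ // S ⊆ D ∧ ∃ m ∈ S, IsOmegaMin D m} :=
      ⟨fun S => h (S.2.2.imp fun _ h1 => h1.2)⟩
    rw [Nat.card_of_isEmpty, Nat.cast_zero]
    refine hasSum_zero.congr_fun fun k => ?_
    exact prod_omegaFactor_sub_of_not_isOmegaMin (Nat.succ_ne_zero k) fun h1 => h ⟨_, h1⟩

theorem Overpartition.isOmega_iff {n : ℕ} (π : Overpartition n) :
    π.IsOmega ↔ ∃ m ∈ π.overlined, IsOmegaMin π.toPartition.parts.toFinset m := by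
  refine exists_congr fun m => ?_
  simp only [IsOmegaMin, IsLeast, lowerBounds, Set.mem_ofPred_eq, Multiset.mem_toFinset]
  constructor
  · rintro ⟨⟨h1, h2⟩, h3, h4⟩
    exact ⟨h3, h1, fun i hi => ⟨h2 hi, h4 i hi⟩⟩
  · rintro ⟨h3, h1, h2⟩
    exact ⟨⟨h1, fun i hi => (h2 i hi).1⟩, h3, fun i hi => (h2 i hi).2⟩

/-- An overpartition of the kind counted by `overpOmega` is a partition together with an admissible
set of overlined part sizes. -/
def omegaEquiv (n : ℕ) : {π : Overpartition n // π.IsOmega} ≃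
    Σ p : n.Partition, {S : Finset ℕ // S ⊆ p.parts.toFinset ∧
      ∃ m ∈ S, IsOmegaMin p.parts.toFinset m} where
  toFun π := ⟨π.1.toPartition, π.1.overlined, π.1.overlined_subset, π.1.isOmega_iff.1 π.2⟩
  invFun x := ⟨⟨x.1, x.2.1, x.2.2.1⟩, (Overpartition.isOmega_iff _).2 x.2.2.2⟩
  left_inv _ := rfl
  right_inv _ := rfl

theorem hasSum_omegaCount (n : ℕ) : HasSum (fun k => omegaCount (k + 1) n) (overpOmega n : ℝ) := by
  have hfin : ∀ p : n.Partition, Finite {S : Finset ℕ // S ⊆ p.parts.toFinset ∧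
      ∃ m ∈ S, IsOmegaMin p.parts.toFinset m} := fun p =>
    Finite.of_injective
      (fun S => (⟨S.1, Finset.mem_powerset.2 S.2.1⟩ : p.parts.toFinset.powerset))
      fun S T h => Subtype.ext (Subtype.mk.inj h)
  rw [overpOmega, Nat.card_congr (omegaEquiv n), Nat.card_sigma, Nat.cast_sum]
  refine (hasSum_sum (s := Finset.univ) fun (p : n.Partition) _ =>
    hasSum_prod_omegaFactor_sub (D := p.parts.toFinset) fun h0 => ?_).congr_fun fun k => ?_
  · exact lt_irrefl _ (p.parts_pos (Multiset.mem_toFinset.1 h0))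
  · rw [omegaCount, partitionWeight, partitionWeight, Finset.sum_sub_distrib]

theorem overpOmega_zero : overpOmega 0 = 0 := by
  have : IsEmpty {π : Overpartition 0 // π.IsOmega} := by
    refine ⟨fun ⟨π, m, hm, _⟩ => ?_⟩
    have h1 := π.toPartition.parts_pos hm.1
    have h2 := Nat.Partition.le_of_mem_parts hm.1
    omega
  exact Nat.card_of_isEmpty

/-! ### The generating function for a fixed smallest part -/

theorem prod_omegaFactorAbove (k L : ℕ) {q : ℂ} (hq : ‖q‖ < 1) :
    ∏ i ∈ Finset.range (2 * k + 1 + 2 * L),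
        (1 + (omegaFactorAbove (k + 1) (i + 1) : ℂ) * (q ^ (i + 1) / (1 - q ^ (i + 1)))) =
      qPoch (-q * q ^ (k + 1)) q k / qPoch (q * q ^ (k + 1)) q k *
        (qPoch (-q * q ^ (2 * k + 1)) (q ^ 2) L / qPoch (q * q ^ (2 * k + 1)) (q ^ 2) L) := by
  have hne : ∀ i : ℕ, 1 - q ^ (i + 1) ≠ 0 := fun i =>
    one_sub_ne_zero_of_norm_lt_one (norm_pow_lt_one hq (Nat.succ_ne_zero i))
  have htwo : ∀ i : ℕ, 1 + ((2 : ℝ) : ℂ) * (q ^ (i + 1) / (1 - q ^ (i + 1))) =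
      (1 + q ^ (i + 1)) / (1 - q ^ (i + 1)) := fun i => by
    have := hne i
    push_cast
    field_simp
    ring
  induction L with
  | zero =>
    rw [mul_zero, add_zero, qPoch_zero, qPoch_zero, div_one, mul_one,
      show 2 * k + 1 = (k + 1) + k by ring, Finset.prod_range_add, Finset.prod_eq_one, one_mul,
      qPoch, qPoch, ← Finset.prod_div_distrib]
    · refine Finset.prod_congr rfl fun j hj => ?_
      have hj' := Finset.mem_range.1 hj
      have h1 : omegaFactorAbove (k + 1) (k + 1 + j + 1) = 2 := by
        simp only [omegaFactorAbove, omegaFactor]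
        rw [if_neg (by omega), if_neg (by omega), if_pos ⟨by omega, fun _ => by omega⟩]
      rw [h1, htwo]
      congr 1 <;> ring
    · intro i hi
      have hi' := Finset.mem_range.1 hi
      have h1 : omegaFactorAbove (k + 1) (i + 1) = 0 := by
        simp only [omegaFactorAbove, omegaFactor]
        split_ifs <;> first | rfl | omega
      simp [h1]
  | succ L ih =>
    have h1 : omegaFactorAbove (k + 1) (2 * k + 1 + 2 * L + 1) = 2 := by
      simp only [omegaFactorAbove, omegaFactor]
      have h : ¬ Odd (2 * k + 1 + 2 * L + 1) := by
        rw [Nat.odd_iff]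
        omega
      rw [if_neg (by omega), if_neg (by omega), if_pos ⟨by omega, fun h' => absurd h' h⟩]
    have h2 : omegaFactorAbove (k + 1) (2 * k + 1 + 2 * L + 1 + 1) = 0 := by
      simp only [omegaFactorAbove, omegaFactor]
      have h : Odd (2 * k + 1 + 2 * L + 1 + 1) := by
        rw [Nat.odd_iff]
        omega
      rw [if_neg (by omega), if_neg (by omega), if_neg fun h' => by have := h'.2 h; omega]
    rw [show 2 * k + 1 + 2 * (L + 1) = 2 * k + 1 + 2 * L + 1 + 1 by ring, Finset.prod_range_succ,
      Finset.prod_range_succ, ih, h1, h2, htwo, qPoch_succ, qPoch_succ, mul_div_mul_comm,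
      Complex.ofReal_zero, zero_mul, add_zero, mul_one, mul_assoc]
    congr 3 <;> ring

theorem prod_omegaFactor (k N : ℕ) (q : ℂ) (hN : k < N) (hq : 1 - q ^ (k + 1) ≠ 0) :
    ∏ i ∈ Finset.range N,
        (1 + (omegaFactor (k + 1) (i + 1) : ℂ) * (q ^ (i + 1) / (1 - q ^ (i + 1)))) =
      1 / (1 - q ^ (k + 1)) * ∏ i ∈ Finset.range N,
        (1 + (omegaFactorAbove (k + 1) (i + 1) : ℂ) * (q ^ (i + 1) / (1 - q ^ (i + 1)))) := by
  rw [← Finset.mul_prod_erase _ _ (Finset.mem_range.2 hN),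
    ← Finset.mul_prod_erase (Finset.range N) (fun i => 1 + (omegaFactorAbove (k + 1) (i + 1) : ℂ) *
      (q ^ (i + 1) / (1 - q ^ (i + 1)))) (Finset.mem_range.2 hN)]
  have h1 : omegaFactor (k + 1) (k + 1) = 1 := by simp [omegaFactor]
  have h2 : omegaFactorAbove (k + 1) (k + 1) = 0 := by simp [omegaFactorAbove]
  rw [h1, h2, Complex.ofReal_one, Complex.ofReal_zero, zero_mul, add_zero, one_mul, one_mul]
  congr 1
  · field_simp
    ring
  · refine Finset.prod_congr rfl fun i hi => ?_
    have hi' : i + 1 ≠ k + 1 := fun h => (Finset.mem_erase.1 hi).1 (by omega)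
    rw [omegaFactorAbove, if_neg hi']

/-- Passage from the two products above the smallest part `k + 1` to products that do not depend
on `k` and shifted factorials of length `k`. -/
theorem qPoch_mul_qPochInf_smallest (s : ℂ) {q : ℂ} (hq : ‖q‖ < 1) (k : ℕ) :
    qPoch (s * q ^ (k + 1)) q k * qPochInf (s * q ^ (2 * k + 1)) (q ^ 2) *
        (qPoch s q (k + 1) * qPochInf s (q ^ 2)) =
      qPochInf s q * ((1 - s) * qPoch (s * q ^ 2) (q ^ 2) k) := by
  have hq2 := norm_pow_lt_one hq two_ne_zero
  have h1 := qPoch_add s q (k + 1) k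
  have h2 := qPoch_two_mul s q k
  have h3 := qPochInf_eq_mul s hq
  have h4 := qPochInf_eq_qPoch_mul (s * q) hq2 k
  have h5 := qPoch_succ s q (2 * k)
  have h6 := qPoch_succ s (q ^ 2) k
  rw [qPoch_succ'] at h6
  rw [show k + 1 + k = 2 * k + 1 by ring, h5, h2, pow_mul] at h1
  rw [← pow_mul, mul_assoc s, ← pow_succ'] at h4
  rw [h3, h4]
  rw [h6]
  linear_combination (-qPochInf (s * q ^ (2 * k + 1)) (q ^ 2) * qPochInf s (q ^ 2)) * h1

theorem hasSum_omegaCount_mul_pow (k : ℕ) {q : ℂ} (hq : ‖q‖ < 1) :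
    HasSum (fun n => (omegaCount (k + 1) n : ℂ) * q ^ n)
      (qPochInf (-q) q / qPochInf q q * q * (qPochInf (q ^ 3) (q ^ 2) / qPochInf (-q) (q ^ 2)) *
        (q ^ k * qPoch (-q ^ 3) (q ^ 2) k * qPoch q q k /
          (qPoch (q ^ 3) (q ^ 2) k * qPoch (-q ^ 2) q k))) := by
  have hq2 := norm_pow_lt_one hq two_ne_zero
  have hqn : ‖-q‖ < 1 := by simpa using hq
  have ht := omegaFactor_nonneg (k + 1)
  have ht2 := omegaFactor_le_two (k + 1)
  have ht' := omegaFactorAbove_nonneg (k + 1)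
  have ht2' := fun i => (omegaFactorAbove_le (k + 1) i).trans (ht2 i)
  have hs := (summable_partitionWeight ht ht2 hq).hasSum.sub
    (summable_partitionWeight ht' ht2' hq).hasSum
  have hlim : Tendsto (fun L : ℕ => 2 * k + 1 + 2 * L) atTop atTop :=
    tendsto_atTop_mono (fun L => by simp only [id]; omega) tendsto_id
  have h1 := (tendsto_prod_partitionWeight ht ht2 hq).comp hlim
  have h2 := (tendsto_prod_partitionWeight ht' ht2' hq).comp hlim
  have hk : ‖q ^ (k + 1)‖ < 1 := norm_pow_lt_one hq (Nat.succ_ne_zero k)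
  have hk0 := one_sub_ne_zero_of_norm_lt_one hk
  have hb : ‖q * q ^ (2 * k + 1)‖ < 1 := norm_mul_pow_lt_one hq hq _
  have hb' : ‖q * q ^ (k + 1)‖ < 1 := norm_mul_pow_lt_one hq hq _
  set V := qPoch (-q * q ^ (k + 1)) q k / qPoch (q * q ^ (k + 1)) q k *
    (qPochInf (-q * q ^ (2 * k + 1)) (q ^ 2) / qPochInf (q * q ^ (2 * k + 1)) (q ^ 2)) with hV
  have h3 : Tendsto (fun L => ∏ i ∈ Finset.range (2 * k + 1 + 2 * L),
      (1 + (omegaFactorAbove (k + 1) (i + 1) : ℂ) * (q ^ (i + 1) / (1 - q ^ (i + 1))))) atTop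
      (𝓝 V) :=
    ((tendsto_qPoch_div _ hb hq2).const_mul _).congr fun L => (prod_omegaFactorAbove k L hq).symm
  have h4 := (h3.const_mul (1 / (1 - q ^ (k + 1)))).congr fun L =>
    (prod_omegaFactor k (2 * k + 1 + 2 * L) q (by omega) hk0).symm
  rw [tendsto_nhds_unique h1 h4, tendsto_nhds_unique h2 h3] at hs
  have hval : 1 / (1 - q ^ (k + 1)) * V - V = qPochInf (-q) q / qPochInf q q * q *
      (qPochInf (q ^ 3) (q ^ 2) / qPochInf (-q) (q ^ 2)) *
        (q ^ k * qPoch (-q ^ 3) (q ^ 2) k * qPoch q q k /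
          (qPoch (q ^ 3) (q ^ 2) k * qPoch (-q ^ 2) q k)) := by
    have a1 := qPoch_mul_qPochInf_smallest q hq k
    have a2 := qPoch_mul_qPochInf_smallest (-q) hq k
    have e1 : qPochInf q (q ^ 2) = (1 - q) * qPochInf (q ^ 3) (q ^ 2) := by
      rw [qPochInf_eq_qPoch_mul q hq2 1, qPoch_succ, qPoch_zero,
        show q * (q ^ 2) ^ 1 = q ^ 3 by ring]
      ring
    rw [show q * q ^ 2 = q ^ 3 by ring, e1, qPoch_succ] at a1
    rw [show -q * q ^ 2 = -q ^ 3 by ring, qPoch_succ', show -q * q = -q ^ 2 by ring] at a2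
    have n1 := one_sub_ne_zero_of_norm_lt_one hq
    have n2 := one_sub_ne_zero_of_norm_lt_one hqn
    have n3 := qPoch_ne_zero hb' hq k
    have n4 := qPochInf_ne_zero hb hq2
    have n5 := qPochInf_ne_zero hq hq
    have n6 := qPochInf_ne_zero hqn hq2
    have n7 := qPoch_ne_zero (norm_pow_lt_one hq three_ne_zero) hq2 k
    have n8 := qPoch_ne_zero (norm_neg_sq_lt_one hq) hq k
    have n9 := qPochInf_ne_zero (norm_pow_lt_one hq three_ne_zero) hq2
    have n10 := qPoch_ne_zero hq hq k
    rw [show q * q ^ k = q ^ (k + 1) by ring] at a1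
    have b1 : qPoch (q * q ^ (k + 1)) q k * qPochInf (q * q ^ (2 * k + 1)) (q ^ 2) =
        qPochInf q q * qPoch (q ^ 3) (q ^ 2) k /
          (qPoch q q k * (1 - q ^ (k + 1)) * qPochInf (q ^ 3) (q ^ 2)) := by
      rw [eq_div_iff (by positivity)]
      refine mul_left_cancel₀ n1 ?_
      linear_combination a1
    have b2 : qPoch (-q * q ^ (k + 1)) q k * qPochInf (-q * q ^ (2 * k + 1)) (q ^ 2) =
        qPochInf (-q) q * qPoch (-q ^ 3) (q ^ 2) k /
          (qPoch (-q ^ 2) q k * qPochInf (-q) (q ^ 2)) := by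
      rw [eq_div_iff (mul_ne_zero n8 n6)]
      refine mul_left_cancel₀ n2 ?_
      linear_combination a2
    rw [hV, ← mul_div_mul_comm, b1, b2]
    field_simp
    ring
  rw [hval] at hs
  refine hs.congr_fun fun n => ?_
  rw [omegaCount, Complex.ofReal_sub, sub_mul]

/-- The generating function of `overpOmega`, summed over the smallest part. -/
theorem hasSum_overpOmega {q : ℂ} (hq0 : q ≠ 0) (hq : ‖q‖ < 1) :
    HasSum (fun n : ℕ => (overpOmega (n + 1) : ℂ) * q ^ (n + 1))
      (qPochInf (-q) q / qPochInf q q * q * (qPochInf (q ^ 3) (q ^ 2) / qPochInf (-q) (q ^ 2)) *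
        ∑' k : ℕ, q ^ k * qPoch (-q ^ 3) (q ^ 2) k * qPoch q q k /
          (qPoch (q ^ 3) (q ^ 2) k * qPoch (-q ^ 2) q k)) := by
  set F : ℕ × ℕ → ℂ := fun x => (omegaCount (x.1 + 1) x.2 : ℂ) * q ^ x.2 with hF
  have hnorm : ∀ k n, ‖F (k, n)‖ = omegaCount (k + 1) n * ‖q‖ ^ n := fun k n => by
    rw [hF, norm_mul, norm_pow, Complex.norm_real, Real.norm_of_nonneg (omegaCount_nonneg _ _)]
  -- Absolute convergence follows from the same formula at the point `‖q‖`.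
  have hr : ‖(‖q‖ : ℂ)‖ < 1 := by simpa using hq
  have hr0 : (‖q‖ : ℂ) ≠ 0 := by simpa using hq0
  have hsum : Summable F := by
    refine Summable.of_norm ((summable_prod_of_nonneg fun _ => norm_nonneg _).2
      ⟨fun k => (hasSum_omegaCount_mul_pow k hq).summable.norm, ?_⟩)
    have h1 := (hasSum_omega_transform hr0 hr).summable.mul_left
      (qPochInf (-(‖q‖ : ℂ)) ‖q‖ / qPochInf ‖q‖ ‖q‖ * ‖q‖ *
        (qPochInf ((‖q‖ : ℂ) ^ 3) ((‖q‖ : ℂ) ^ 2) / qPochInf (-(‖q‖ : ℂ)) ((‖q‖ : ℂ) ^ 2)))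
    rw [← Complex.summable_ofReal]
    refine h1.congr fun k => ?_
    rw [← (hasSum_omegaCount_mul_pow k hr).tsum_eq, Complex.ofReal_tsum]
    refine tsum_congr fun n => ?_
    rw [hnorm]
    push_cast
    rfl
  have h1 : HasSum (fun k => ∑' n, F (k, n)) (∑' x, F x) :=
    hsum.hasSum.prod_fiberwise fun k => (hasSum_omegaCount_mul_pow k hq).summable.hasSum
  have h2 : HasSum (fun n => (overpOmega n : ℂ) * q ^ n) (∑' x, F x) := by
    have h : ∀ n, HasSum (fun k => (F ∘ Equiv.prodComm ℕ ℕ) (n, k))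
        ((overpOmega n : ℂ) * q ^ n) := fun n => by
      have h3 := (Complex.hasSum_ofReal.2 (hasSum_omegaCount n)).mul_right (q ^ n)
      rwa [Complex.ofReal_natCast] at h3
    exact ((Equiv.prodComm ℕ ℕ).hasSum_iff.2 hsum.hasSum).prod_fiberwise h
  have h3 := h1.unique (((hasSum_omega_transform hq0 hq).summable.hasSum.mul_left _).congr_fun
    fun k => (hasSum_omegaCount_mul_pow k hq).tsum_eq)
  rw [h3, ← hasSum_nat_add_iff' 1] at h2
  simpa [overpOmega_zero] using h2

/-! ### The identities -/

theorem theorem1p2 (q : ℂ) (hq0 : q ≠ 0) (hq1 : ‖q‖ < 1) :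
    (Summable (fun n : ℕ =>
        q ^ n * qPoch (-q ^ 3) (q ^ 2) n * qPoch q q n /
          (qPoch (q ^ 3) (q ^ 2) n * qPoch (-q ^ 2) q n)) ∧
      Summable (fun n : ℕ =>
        qPoch (-1) q n * qPoch (-q) (q ^ 2) n / (qPoch q (q ^ 2) n * qPoch q q n) * q ^ n) ∧
      Summable (fun n : ℕ =>
        qPoch q (q ^ 2) n * (-q) ^ n / (qPoch (-q) (q ^ 2) n * (1 + q ^ (2 * n))) *
          littleQJacobi (2 * n) (-1) (q ^ (-2 * (n : ℤ) - 1)) (-1) q)) ∧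
    (∑' n : ℕ,
        q ^ n * qPoch (-q ^ 3) (q ^ 2) n * qPoch q q n /
          (qPoch (q ^ 3) (q ^ 2) n * qPoch (-q ^ 2) q n) =
      1 / 2 * (1 - 1 / q) * (qPochInf q q ^ 2 / qPochInf (-q) q ^ 2) *
          (∑' n : ℕ,
            qPoch (-1) q n * qPoch (-q) (q ^ 2) n / (qPoch q (q ^ 2) n * qPoch q q n) * q ^ n) +
        1 / q * (qPochInf (-q) (q ^ 2) / qPochInf (q ^ 3) (q ^ 2)) *
          (∑' n : ℕ,
            qPoch q (q ^ 2) n * (-q) ^ n / (qPoch (-q) (q ^ 2) n * (1 + q ^ (2 * n))) *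
              littleQJacobi (2 * n) (-1) (q ^ (-2 * (n : ℤ) - 1)) (-1) q)) ∧
    HasSum (fun n : ℕ => (overpOmega (n + 1) : ℂ) * q ^ (n + 1))
      (-(1 / 2) *
            (qPochInf q q * qPochInf q (q ^ 2) / (qPochInf (-q) q * qPochInf (-q) (q ^ 2))) *
          (∑' n : ℕ,
            qPoch (-1) q n * qPoch (-q) (q ^ 2) n / (qPoch q (q ^ 2) n * qPoch q q n) * q ^ n) +
        qPochInf (-q) q / qPochInf q q *
          (∑' n : ℕ,
            qPoch q (q ^ 2) n * (-q) ^ n / (qPoch (-q) (q ^ 2) n * (1 + q ^ (2 * n))) *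
              littleQJacobi (2 * n) (-1) (q ^ (-2 * (n : ℤ) - 1)) (-1) q)) := by

  have hq2 := norm_pow_lt_one hq1 two_ne_zero
  have hqn : ‖-q‖ < 1 := by simpa using hq1
  have h1 := hasSum_omega_transform hq0 hq1
  have h2 := hasSum_qPoch_transform hq1
  have h3 := summable_weight_mul_littleQJacobi hq0 hq1
  have h4 := hasSum_overpOmega hq0 hq1
  have n1 := qPochInf_ne_zero hq1 hq1
  have n2 := qPochInf_ne_zero hqn hq1
  have n3 := qPochInf_ne_zero hqn hq2
  have n4 := qPochInf_ne_zero (norm_pow_lt_one hq1 three_ne_zero) hq2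
  have n5 := one_sub_ne_zero_of_norm_lt_one hq1
  have e1 : qPochInf q (q ^ 2) = (1 - q) * qPochInf (q ^ 3) (q ^ 2) := by
    rw [qPochInf_eq_qPoch_mul q hq2 1, qPoch_succ, qPoch_zero,
      show q * (q ^ 2) ^ 1 = q ^ 3 by ring]
    ring
  refine ⟨⟨h1.summable, h2.summable, h3⟩, ?_, ?_⟩
  · rw [h1.tsum_eq, h2.tsum_eq, e1]
    field_simp
    ring
  · convert h4 using 1
    rw [h1.tsum_eq, h2.tsum_eq, e1]
    field_simp
    ring
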